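/- Let $\Theta\subset\mathbb{R}^{d_1}$ be compact, partitioned into non-empty disjoint sets $\Theta_0$ and $\Theta_1=\Theta\setminus\Theta_0$ with $\Theta_0$ closed. Let $\mu$ be a $\sigma$-finite measure on an observation space $\mathbb{Y}\subset\mathbb{R}^{d_2}$, and for each $\theta\in\Theta$ let $f_\theta\ge 0$ be a probability density with respect to $\mu$, with $(\theta,y)\mapsto f_\theta(y)$ jointly measurable. Assume that $\int_{\mathbb{Y}}|f_{\theta_n}-f_\theta|\,d\mu\to 0$ whenever $\theta_n\to\theta$ in $\Theta$, and that the distributions $\mu_\theta(dy)=f_\theta(y)\,\mu(dy)$, $\theta\in\Theta$, are pairwise mutually absolutely continuous. Let $\Delta$ be the set of measurable functions $\delta:\mathbb{Y}\to[0,1]$ (randomized decision rules), and for $\delta\in\Delta$ put $p(\theta;\delta)=\int_{\mathbb{Y}}\delta(y)f_\theta(y)\,\mu(dy)$. Let $\Lambda_1$ be a probability measure on $\Theta_1$, let $\alpha\in(0,1)$, and let $g:[0,1]\to\mathbb{R}$ be continuous on $[0,1]$ and continuously differentiable on $(0,1)$, with $g'(t)>0$ for $0<t<1$. Consider the problem $$\max_{\delta\in\Delta}\int_{\Theta_1}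 g(p(\theta;\delta))\,\Lambda_1(d\theta)\quad\text{subject to}\quad \sup_{\theta\in\Theta_0}p(\theta;\delta)\le\alpha .$$ Then there exists an optimal rule $\delta^*\in\Delta$ for this problem such that $\sup_{\theta\in\Theta_0}p(\theta;\delta^*)=\alpha$ and $0<p(\theta;\delta^*)<1$ for all $\theta\in\Theta$, and there exist a constant $\kappa\ge 0$, a measurable function $\gamma:\mathbb{Y}\to[0,1]$ and a probability measure $\widetilde\Lambda_0$ on $\Theta_0$ such that, for every $y\in\mathbb{Y}$, $$\delta^*(y)=\begin{cases}1,& H(y)>\kappa\,\widetilde f_{\widetilde\Lambda_0}(y),\\ \gamma(y),& H(y)=\kappa\,\widetilde f_{\widetilde\Lambda_0}(y),\\ 0,& H(y)<\kappa\,\widetilde f_{\widetilde\Lambda_0}(y),\end{cases}$$ where $$H(y)=\int_{\Theta_1}g'(p(\theta;\delta^*))\,f_\theta(y)\,\Lambda_1(d\theta)\in[0,\infty],\qquad \widetilde f_{\Lambda}(y)=\int_{\Theta_0}f_\theta(y)\,\Lambda(d\theta)\in[0,\infty].$$ Moreover $\widetilde\Lambda_0$ is least favorable for testing $\{f_\theta:\theta\in\Theta_0\}$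 against the simple alternative with density proportional to $H$ at level $\alpha$: for every probability measure $\Lambda$ on $\Theta_0$, $$\sup\Big\{\int_{\mathbb{Y}}\delta H\,d\mu:\ \delta\in\Delta,\ \int_{\mathbb{Y}}\delta\,\widetilde f_{\widetilde\Lambda_0}\,d\mu\le\alpha\Big\}\ \le\ \sup\Big\{\int_{\mathbb{Y}}\delta H\,d\mu:\ \delta\in\Delta,\ \int_{\mathbb{Y}}\delta\,\widetilde f_{\Lambda}\,d\mu\le\alpha\Big\}.$$ -/

import Mathlib

open MeasureTheory Set Filter Topology
open scoped ENNReal NNReal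

namespace CompositeNP

section

variable {Θ Y : Type*} [MeasurableSpace Θ] [MeasurableSpace Y]

/-- `f θ` is a probability density function with respect to `μ` for every parameter `θ`, and
`(θ, y) ↦ f θ y` is jointly measurable. -/
structure IsDensityFamily (μ : Measure Y) (f : Θ → Y → ℝ) : Prop where
  measurable : Measurable (Function.uncurry f)
  nonneg : ∀ θ y, 0 ≤ f θ y
  lintegral_eq_one : ∀ θ, ∫⁻ y, ENNReal.ofReal (f θ y) ∂μ = 1

/-- The distribution of the observation when `θ` is the true parameter. -/
noncomputable def law (μ : Measure Y) (f : Θ → Y → ℝ) (θ : Θ) : Measure Y :=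
  μ.withDensity fun y => ENNReal.ofReal (f θ y)

/-- The map from parameters to laws is (sequentially) continuous in total variation, and any two
of the laws are mutually absolutely continuous. -/
structure IsTVContinuousFamily [TopologicalSpace Θ] (μ : Measure Y) (f : Θ → Y → ℝ) : Prop where
  tendsto : ∀ (u : ℕ → Θ) (θ : Θ), Tendsto u atTop (𝓝 θ) →
    Tendsto (fun n => ∫⁻ y, ENNReal.ofReal |f (u n) y - f θ y| ∂μ) atTop (𝓝 0)
  absolutelyContinuous : ∀ θ θ' : Θ, law μ f θ ≪ law μ f θ'

/-- Randomized decision rules: measurable functions with values in `[0, 1]`; the value at `y` is the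
probability of rejecting the null hypothesis when `y` is observed. -/
def decisionRules (Y : Type*) [MeasurableSpace Y] : Set (Y → ℝ) :=
  {δ | Measurable δ ∧ ∀ y, δ y ∈ Icc (0 : ℝ) 1}

/-- The power function `p(θ; δ) = ∫ δ(y) f_θ(y) μ(dy)`. -/
noncomputable def power (μ : Measure Y) (f : Θ → Y → ℝ) (δ : Y → ℝ) (θ : Θ) : ℝ :=
  ∫ y, δ y * f θ y ∂μ

/-- The objective `∫_{Θ₁} g(p(θ; δ)) Λ₁(dθ)`, where `Θ₁` is the complement of `Θ₀`. -/
noncomputable def objective (μ : Measure Y) (f : Θ → Y → ℝ) (g : ℝ → ℝ) {Θ₀ : Set Θ}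
    (Λ₁ : Measure ↥Θ₀ᶜ) (δ : Y → ℝ) : ℝ :=
  ∫ θ : ↥Θ₀ᶜ, g (power μ f δ θ) ∂Λ₁

/-- Rules whose worst-case false-alarm probability `sup_{θ ∈ Θ₀} p(θ; δ)` is at most `α`. -/
def feasibleRules (μ : Measure Y) (f : Θ → Y → ℝ) (Θ₀ : Set Θ) (α : ℝ) : Set (Y → ℝ) :=
  {δ | δ ∈ decisionRules Y ∧ ⨆ θ : Θ₀, power μ f δ θ ≤ α}

/-- `δ` maximizes the objective among all rules with worst-case false-alarm probability at most
`α`. -/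
def IsOptimalRule (μ : Measure Y) (f : Θ → Y → ℝ) (g : ℝ → ℝ) {Θ₀ : Set Θ}
    (Λ₁ : Measure ↥Θ₀ᶜ) (α : ℝ) (δ : Y → ℝ) : Prop :=
  δ ∈ feasibleRules μ f Θ₀ α ∧
    ∀ δ' ∈ feasibleRules μ f Θ₀ α, objective μ f g Λ₁ δ' ≤ objective μ f g Λ₁ δ

/-- `H(y) = ∫_{Θ₁} g'(p(θ; δ)) f_θ(y) Λ₁(dθ)`, with values in `[0, ∞]`
(the integrand is nonnegative when `0 < p(θ; δ) < 1` and `g' > 0` on `(0, 1)`). -/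
noncomputable def weightedAlternative (μ : Measure Y) (f : Θ → Y → ℝ) (g : ℝ → ℝ) {Θ₀ : Set Θ}
    (Λ₁ : Measure ↥Θ₀ᶜ) (δ : Y → ℝ) (y : Y) : ℝ≥0∞ :=
  ∫⁻ θ : ↥Θ₀ᶜ, ENNReal.ofReal (deriv g (power μ f δ θ) * f θ y) ∂Λ₁

/-- The integrated null density `∫_{Θ₀} f_θ(y) Λ₀(dθ)`, with values in `[0, ∞]`. -/
noncomputable def mixedNull (f : Θ → Y → ℝ) {Θ₀ : Set Θ} (Λ₀ : Measure ↥Θ₀) (y : Y) : ℝ≥0∞ :=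
  ∫⁻ θ : ↥Θ₀, ENNReal.ofReal (f θ y) ∂Λ₀

/-- The largest value of `∫ δ h dμ` over the rules `δ` of level `α` for the simple null hypothesis
with density `f₀`: the power of the most powerful level-`α` test of `f₀` against the simple
alternative `h` (up to the factor `∫ h dμ`, if `h` is not normalized). -/
noncomputable def bestPower (μ : Measure Y) (f₀ h : Y → ℝ≥0∞) (α : ℝ) : ℝ≥0∞ :=
  ⨆ δ ∈ {δ ∈ decisionRules Y | ∫⁻ y, ENNReal.ofReal (δ y) * f₀ y ∂μ ≤ ENNReal.ofReal α},
    ∫⁻ y, ENNReal.ofReal (δ y) * h y ∂μ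

/-- `Λ₀` is a least-favorable distribution at level `α` for testing `{f_θ : θ ∈ Θ₀}` against the
simple alternative whose density is proportional to `h`: among all probability measures on `Θ₀`,
it minimizes the power of the most powerful level-`α` test of the integrated null density. -/
def IsLeastFavorable (μ : Measure Y) (f : Θ → Y → ℝ) {Θ₀ : Set Θ} (α : ℝ) (h : Y → ℝ≥0∞)
    (Λ₀ : Measure ↥Θ₀) : Prop :=
  IsProbabilityMeasure Λ₀ ∧
    ∀ Λ : Measure ↥Θ₀, IsProbabilityMeasure Λ →
      bestPower μ (mixedNull f Λ₀) h α ≤ bestPower μ (mixedNull f Λ) h α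

end

end CompositeNP

/-! A rule enters the problem only through its power function. Continuity in total variation makes
power functions equicontinuous, so they are relatively compact in the uniform norm; a limit is again
a power function because minimal-norm points of nested convex sets in L² converge, which replaces
weak compactness (`isCompact_powerFunctions`). The objective is continuous in the power function, so
a maximizer exists. Mixing it with the constant rule 1 brings its worst-case level up to exactly α
at no loss, and mutual absolute continuity then keeps its power inside (0, 1).

Compactness even keeps the power away from 0 and 1, where g' might blow up, so the objective can be
differentiated towards any feasible rule: δ* also maximizes the linear functional ∫ δ H dμ
(`IsOptimalRule.integral_deriv_mul_le`). Hahn–Banach in C(Θ₀) × ℝ and Riesz representation turn the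
level constraint into a measure κΛ₀ on Θ₀ (`exists_null_multiplier`). Hence δ* maximizes ∫ δ (H - κ
f̃) dμ over all rules, which forces the likelihood ratio form almost everywhere
(`exists_ae_eq_likelihoodRatioRule`).

Least favorability is duality: by the penalized inequality, no rule of level α for the Λ₀-mixture
beats δ*, while δ* has level α for every mixture. -/

namespace CompositeNP

/-! ### Power functions: bounds, affinity in the rule, equicontinuity -/

section Power

variable {Θ Y : Type*} [MeasurableSpace Θ] [MeasurableSpace Y] {μ : Measure Y} {f : Θ → Y → ℝ}
  {δ δ' : Y → ℝ}

theorem IsDensityFamily.measurable_density (hf : IsDensityFamily μ f) (θ : Θ) :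
    Measurable (f θ) :=
  hf.measurable.of_uncurry_left

theorem IsDensityFamily.integrable (hf : IsDensityFamily μ f) (θ : Θ) : Integrable (f θ) μ := by
  refine ⟨(hf.measurable_density θ).aestronglyMeasurable, ?_⟩
  rw [hasFiniteIntegral_iff_ofReal (Eventually.of_forall (hf.nonneg θ)), hf.lintegral_eq_one θ]
  exact ENNReal.one_lt_top

theorem IsDensityFamily.integral_eq_one (hf : IsDensityFamily μ f) (θ : Θ) :
    ∫ y, f θ y ∂μ = 1 := by
  rw [integral_eq_lintegral_of_nonneg_ae (Eventually.of_forall (hf.nonneg θ))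
    (hf.measurable_density θ).aestronglyMeasurable, hf.lintegral_eq_one θ, ENNReal.toReal_one]

theorem IsDensityFamily.isProbabilityMeasure_law (hf : IsDensityFamily μ f) (θ : Θ) :
    IsProbabilityMeasure (law μ f θ) :=
  ⟨by rw [law, withDensity_apply _ MeasurableSet.univ, Measure.restrict_univ,
    hf.lintegral_eq_one θ]⟩

theorem convex_decisionRules : Convex ℝ (decisionRules Y) := by
  intro δ hδ δ' hδ' a b ha hb hab
  refine ⟨(hδ.1.const_smul a).add (hδ'.1.const_smul b), fun y => ?_⟩
  exact convex_Icc (0 : ℝ) 1 (hδ.2 y) (hδ'.2 y) ha hb hab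

theorem const_mem_decisionRules {c : ℝ} (hc : c ∈ Icc (0 : ℝ) 1) :
    (fun _ => c) ∈ decisionRules Y :=
  ⟨measurable_const, fun _ => hc⟩

theorem one_sub_mem_decisionRules (hδ : δ ∈ decisionRules Y) :
    (fun y => 1 - δ y) ∈ decisionRules Y :=
  ⟨hδ.1.const_sub 1, fun y => ⟨by linarith [(hδ.2 y).2], by linarith [(hδ.2 y).1]⟩⟩

theorem integrable_mul_density (hf : IsDensityFamily μ f) (hδ : δ ∈ decisionRules Y) (θ : Θ) :
    Integrable (fun y => δ y * f θ y) μ := by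
  refine (hf.integrable θ).mono (hδ.1.mul (hf.measurable_density θ)).aestronglyMeasurable
    (Eventually.of_forall fun y => ?_)
  rw [norm_mul]
  refine mul_le_of_le_one_left (norm_nonneg _) ?_
  rw [Real.norm_of_nonneg (hδ.2 y).1]
  exact (hδ.2 y).2

theorem power_nonneg (hf : IsDensityFamily μ f) (hδ : δ ∈ decisionRules Y) (θ : Θ) :
    0 ≤ power μ f δ θ :=
  integral_nonneg fun y => mul_nonneg (hδ.2 y).1 (hf.nonneg θ y)

theorem power_const (hf : IsDensityFamily μ f) (c : ℝ) (θ : Θ) :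
    power μ f (fun _ => c) θ = c := by
  rw [power, integral_const_mul, hf.integral_eq_one, mul_one]

theorem power_one_sub (hf : IsDensityFamily μ f) (hδ : δ ∈ decisionRules Y) (θ : Θ) :
    power μ f (fun y => 1 - δ y) θ = 1 - power μ f δ θ := by
  simp only [power, sub_mul, one_mul]
  rw [integral_sub (hf.integrable θ) (integrable_mul_density hf hδ θ), hf.integral_eq_one]

theorem power_mem_Icc (hf : IsDensityFamily μ f) (hδ : δ ∈ decisionRules Y) (θ : Θ) :
    power μ f δ θ ∈ Icc (0 : ℝ) 1 :=
  ⟨power_nonneg hf hδ θ, by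
    linarith [power_one_sub hf hδ θ, power_nonneg hf (one_sub_mem_decisionRules hδ) θ]⟩

theorem power_smul_add_smul (hf : IsDensityFamily μ f) (hδ : δ ∈ decisionRules Y)
    (hδ' : δ' ∈ decisionRules Y) (a b : ℝ) (θ : Θ) :
    power μ f (a • δ + b • δ') θ = a * power μ f δ θ + b * power μ f δ' θ := by
  simp only [power, Pi.add_apply, Pi.smul_apply, smul_eq_mul, add_mul, mul_assoc]
  rw [integral_add ((integrable_mul_density hf hδ θ).const_mul a)
    ((integrable_mul_density hf hδ' θ).const_mul b), integral_const_mul, integral_const_mul]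

omit [MeasurableSpace Θ] in
theorem power_congr_ae (h : δ =ᵐ[μ] δ') (θ : Θ) : power μ f δ θ = power μ f δ' θ :=
  integral_congr_ae (h.mono fun y hy => by simp only [hy])

theorem ofReal_power (hf : IsDensityFamily μ f) (hδ : δ ∈ decisionRules Y) (θ : Θ) :
    ENNReal.ofReal (power μ f δ θ)
      = ∫⁻ y, ENNReal.ofReal (δ y) * ENNReal.ofReal (f θ y) ∂μ := by
  rw [power, ofReal_integral_eq_lintegral_ofReal (integrable_mul_density hf hδ θ)
    (Eventually.of_forall fun y => mul_nonneg (hδ.2 y).1 (hf.nonneg θ y))]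
  exact lintegral_congr fun y => ENNReal.ofReal_mul (hδ.2 y).1

theorem power_eq_integral_law (hf : IsDensityFamily μ f) (δ : Y → ℝ) (θ : Θ) :
    power μ f δ θ = ∫ y, δ y ∂(law μ f θ) := by
  rw [law, integral_withDensity_eq_integral_toReal_smul
    (hf.measurable_density θ).ennreal_ofReal (by simp)]
  refine integral_congr_ae (Eventually.of_forall fun y => ?_)
  simp only [ENNReal.toReal_ofReal (hf.nonneg θ y), smul_eq_mul, mul_comm]

theorem integrable_law (hf : IsDensityFamily μ f) (hδ : δ ∈ decisionRules Y) (θ : Θ) :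
    Integrable δ (law μ f θ) := by
  have := hf.isProbabilityMeasure_law θ
  refine Integrable.of_bound hδ.1.aestronglyMeasurable 1 (Eventually.of_forall fun y => ?_)
  rw [Real.norm_of_nonneg (hδ.2 y).1]
  exact (hδ.2 y).2

/-- Zero power means that the rule vanishes almost surely under that law, and null sets are common
to all the laws. -/
theorem power_eq_zero_of_power_eq_zero [TopologicalSpace Θ] (hf : IsDensityFamily μ f)
    (hcont : IsTVContinuousFamily μ f) (hδ : δ ∈ decisionRules Y) {θ : Θ}
    (h : power μ f δ θ = 0) (θ' : Θ) : power μ f δ θ' = 0 := by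
  rw [power_eq_integral_law hf] at h ⊢
  rw [integral_eq_zero_iff_of_nonneg (fun y => (hδ.2 y).1) (integrable_law hf hδ θ)] at h
  exact integral_eq_zero_of_ae ((hcont.absolutelyContinuous θ' θ).ae_le h)

theorem power_eq_one_of_power_eq_one [TopologicalSpace Θ] (hf : IsDensityFamily μ f)
    (hcont : IsTVContinuousFamily μ f) (hδ : δ ∈ decisionRules Y) {θ : Θ}
    (h : power μ f δ θ = 1) (θ' : Θ) : power μ f δ θ' = 1 := by
  have := power_eq_zero_of_power_eq_zero hf hcont (one_sub_mem_decisionRules hδ) (θ := θ)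
    (by rw [power_one_sub hf hδ, h, sub_self]) θ'
  rw [power_one_sub hf hδ] at this
  linarith

theorem bddAbove_range_power (hf : IsDensityFamily μ f) (hδ : δ ∈ decisionRules Y)
    (S : Set Θ) : BddAbove (range fun θ : S => power μ f δ θ) :=
  ⟨1, by rintro _ ⟨θ, rfl⟩; exact (power_mem_Icc hf hδ θ).2⟩

theorem mem_feasibleRules_iff (hf : IsDensityFamily μ f) {Θ₀ : Set Θ} (hΘ₀ : Θ₀.Nonempty)
    {α : ℝ} : δ ∈ feasibleRules μ f Θ₀ α ↔
      δ ∈ decisionRules Y ∧ ∀ θ ∈ Θ₀, power μ f δ θ ≤ α := by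
  have := hΘ₀.to_subtype
  constructor
  · rintro ⟨h, h'⟩
    exact ⟨h, fun θ hθ => (le_ciSup (bddAbove_range_power hf h Θ₀) ⟨θ, hθ⟩).trans h'⟩
  · rintro ⟨h, h'⟩
    exact ⟨h, ciSup_le fun θ => h' θ θ.2⟩

/-- If the worst-case power over `Θ₀` lies strictly between `0` and `1`, so does the power at
every parameter. -/
theorem power_mem_Ioo [TopologicalSpace Θ] (hf : IsDensityFamily μ f)
    (hcont : IsTVContinuousFamily μ f) (hδ : δ ∈ decisionRules Y) {Θ₀ : Set Θ}
    (hΘ₀ : Θ₀.Nonempty) (h : (⨆ θ : Θ₀, power μ f δ θ) ∈ Ioo (0 : ℝ) 1) (θ : Θ) :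
    power μ f δ θ ∈ Ioo (0 : ℝ) 1 := by
  have := hΘ₀.to_subtype
  have hmem := power_mem_Icc hf hδ θ
  refine ⟨hmem.1.lt_of_ne' fun h0 => ?_, hmem.2.lt_of_ne fun h1 => ?_⟩
  · simp [power_eq_zero_of_power_eq_zero hf hcont hδ h0] at h
  · simp [power_eq_one_of_power_eq_one hf hcont hδ h1] at h

theorem abs_power_sub_le (hf : IsDensityFamily μ f) (hδ : δ ∈ decisionRules Y) (θ θ' : Θ) :
    |power μ f δ θ - power μ f δ θ'|
      ≤ (∫⁻ y, ENNReal.ofReal |f θ' y - f θ y| ∂μ).toReal := by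
  have hint : Integrable (fun y => |f θ' y - f θ y|) μ :=
    ((hf.integrable θ').sub (hf.integrable θ)).abs
  rw [← integral_eq_lintegral_of_nonneg_ae (Eventually.of_forall fun y => abs_nonneg _)
    hint.aestronglyMeasurable, power, power,
    ← integral_sub (integrable_mul_density hf hδ θ) (integrable_mul_density hf hδ θ')]
  refine abs_integral_le_integral_abs.trans (integral_mono_of_nonneg
    (Eventually.of_forall fun y => abs_nonneg _) hint (Eventually.of_forall fun y => ?_))
  simp only [← mul_sub, abs_mul, abs_sub_comm (f θ' y)]
  refine mul_le_of_le_one_left (abs_nonneg _) ?_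
  rw [abs_of_nonneg (hδ.2 y).1]
  exact (hδ.2 y).2

/-- Since rules take values in [0, 1], the L¹ distance of the densities is a modulus of continuity
that does not depend on the rule. -/
theorem equicontinuous_power [TopologicalSpace Θ] [FirstCountableTopology Θ]
    (hf : IsDensityFamily μ f) (hcont : IsTVContinuousFamily μ f) :
    Equicontinuous fun δ : decisionRules Y => power μ f (δ : Y → ℝ) := by
  intro θ
  refine Metric.equicontinuousAt_of_continuity_modulus
    (fun θ' => (∫⁻ y, ENNReal.ofReal |f θ' y - f θ y| ∂μ).toReal) ?_ _
    (Eventually.of_forall fun θ' δ => abs_power_sub_le hf δ.2 θ θ')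
  refine tendsto_of_seq_tendsto fun u hu => ?_
  have := (ENNReal.tendsto_toReal ENNReal.zero_ne_top).comp (hcont.tendsto u θ hu)
  rwa [ENNReal.toReal_zero] at this

theorem continuous_power [TopologicalSpace Θ] [FirstCountableTopology Θ]
    (hf : IsDensityFamily μ f) (hcont : IsTVContinuousFamily μ f) (hδ : δ ∈ decisionRules Y) :
    Continuous (power μ f δ) :=
  (equicontinuous_power hf hcont).continuous ⟨δ, hδ⟩

end Power

/-! ### Mixtures of densities and Tonelli -/

section Mixture

variable {Θ Y : Type*} [MeasurableSpace Θ] [MeasurableSpace Y] {μ : Measure Y} {f : Θ → Y → ℝ}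
  {δ : Y → ℝ}

/-- The weight `w` and the map `ι` let one statement serve both H (weight g'(p) on Θ₁) and the null
mixture (weight 1 on Θ₀). -/
theorem measurable_mixture (hf : IsDensityFamily μ f) {T : Type*} [MeasurableSpace T]
    (ν : Measure T) [SFinite ν] {ι : T → Θ} (hι : Measurable ι) {w : T → ℝ≥0∞}
    (hw : Measurable w) :
    Measurable fun y => ∫⁻ t, w t * ENNReal.ofReal (f (ι t) y) ∂ν := by
  refine Measurable.lintegral_prod_right' (f := fun p : Y × T =>
    w p.2 * ENNReal.ofReal (f (ι p.2) p.1)) ?_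
  exact (hw.comp measurable_snd).mul
    (hf.measurable.comp ((hι.comp measurable_snd).prodMk measurable_fst)).ennreal_ofReal

theorem lintegral_mul_mixture [SigmaFinite μ] (hf : IsDensityFamily μ f)
    (hδ : δ ∈ decisionRules Y) {T : Type*} [MeasurableSpace T] (ν : Measure T) [SFinite ν]
    {ι : T → Θ} (hι : Measurable ι) {w : T → ℝ≥0∞} (hw : Measurable w) :
    ∫⁻ y, ENNReal.ofReal (δ y) * ∫⁻ t, w t * ENNReal.ofReal (f (ι t) y) ∂ν ∂μ
      = ∫⁻ t, w t * ENNReal.ofReal (power μ f δ (ι t)) ∂ν := by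
  have hm : Measurable fun p : T × Y => ENNReal.ofReal (f (ι p.1) p.2) :=
    (hf.measurable.comp ((hι.comp measurable_fst).prodMk measurable_snd)).ennreal_ofReal
  have hδm : Measurable fun y => ENNReal.ofReal (δ y) := hδ.1.ennreal_ofReal
  calc _ = ∫⁻ y, ∫⁻ t, ENNReal.ofReal (δ y) * (w t * ENNReal.ofReal (f (ι t) y)) ∂ν ∂μ := by
        refine lintegral_congr fun y => (lintegral_const_mul _ ?_).symm
        exact hw.mul (hm.comp measurable_prodMk_right)
    _ = ∫⁻ t, ∫⁻ y, ENNReal.ofReal (δ y) * (w t * ENNReal.ofReal (f (ι t) y)) ∂μ ∂ν := by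
        refine lintegral_lintegral_swap (Measurable.aemeasurable ?_)
        exact (hδm.comp measurable_fst).mul
          ((hw.comp measurable_snd).mul (hm.comp measurable_swap))
    _ = _ := by
        refine lintegral_congr fun t => ?_
        rw [ofReal_power hf hδ, ← lintegral_const_mul]
        · exact lintegral_congr fun y => by ring
        · exact hδm.mul (hm.comp measurable_prodMk_left)

end Mixture

/-! ### Compactness of the power functions and existence of an optimal rule -/

section Compactness

/-- In a bounded decreasing sequence of nonempty convex sets of an inner product space, points of
almost minimal norm form a Cauchy sequence. -/
theorem exists_cauchySeq_mem_of_antitone_convex {E : Type*} [NormedAddCommGroup E]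
    [InnerProductSpace ℝ E] {C : ℕ → Set E} (hne : ∀ n, (C n).Nonempty)
    (hconv : ∀ n, Convex ℝ (C n)) (hanti : Antitone C) {R : ℝ}
    (hR : ∀ n, ∀ x ∈ C n, ‖x‖ ≤ R) :
    ∃ x : ℕ → E, (∀ n, x n ∈ C n) ∧ CauchySeq x := by
  let s : ℕ → ℝ := fun n => sInf ((fun x => ‖x‖ ^ 2) '' C n)
  have hbdd : ∀ n, BddBelow ((fun x => ‖x‖ ^ 2) '' C n) := fun n =>
    ⟨0, by rintro _ ⟨x, -, rfl⟩; positivity⟩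
  have hle : ∀ n, ∀ x ∈ C n, s n ≤ ‖x‖ ^ 2 := fun n x hx => csInf_le (hbdd n) ⟨x, hx, rfl⟩
  have hmono : Monotone s := fun n m hnm =>
    csInf_le_csInf (hbdd n) ((hne m).image _) (image_mono (hanti hnm))
  have hsR : ∀ n, s n ≤ R ^ 2 := fun n => by
    obtain ⟨x, hx⟩ := hne n
    exact (hle n x hx).trans (pow_le_pow_left₀ (norm_nonneg _) (hR n x hx) 2)
  have hsB : BddAbove (range s) := ⟨R ^ 2, by rintro _ ⟨n, rfl⟩; exact hsR n⟩
  have hlim := tendsto_atTop_ciSup hmono hsB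
  set S := ⨆ n, s n
  have hex : ∀ n, ∃ x ∈ C n, ‖x‖ ^ 2 < s n + 1 / ((n : ℝ) + 1) := by
    intro n
    obtain ⟨_, ⟨x, hx, rfl⟩, hlt⟩ := exists_lt_of_csInf_lt ((hne n).image fun x => ‖x‖ ^ 2)
      (lt_add_of_pos_right (s n) (Nat.one_div_pos_of_nat (n := n)))
    exact ⟨x, hx, hlt⟩
  choose x hx hxlt using hex
  -- For n ≤ m the midpoint of `x n` and `x m` lies in `C n`, so its squared norm is at least `s n`.
  -- The parallelogram law then gives ‖x n - x m‖² ≤ 2 (s m - s n) + 4 / (n + 1).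
  refine ⟨x, hx, cauchySeq_of_le_tendsto_0'
    (fun n => Real.sqrt (2 * (S - s n) + 4 * (1 / ((n : ℝ) + 1)))) (fun n m hnm => ?_) ?_⟩
  · rw [dist_eq_norm]
    refine Real.le_sqrt_of_sq_le ?_
    have hmid : (1 / 2 : ℝ) • x n + (1 / 2 : ℝ) • x m ∈ C n :=
      hconv n (hx n) (hanti hnm (hx m)) (by norm_num) (by norm_num) (by norm_num)
    have h1 := hle n _ hmid
    rw [← smul_add, norm_smul, mul_pow] at h1
    have h2 := parallelogram_law_with_norm ℝ (x n) (x m)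
    have h3 : s m ≤ S := le_ciSup hsB m
    have h4 : (1 : ℝ) / ((m : ℝ) + 1) ≤ 1 / ((n : ℝ) + 1) := Nat.one_div_le_one_div hnm
    have h5 := hxlt n
    have h6 := hxlt m
    norm_num at h1
    nlinarith
  · have : Tendsto (fun n : ℕ => 2 * (S - s n) + 4 * (1 / ((n : ℝ) + 1))) atTop
        (𝓝 (2 * (S - S) + 4 * 0)) :=
      ((tendsto_const_nhds.sub hlim).const_mul 2).add
        (tendsto_one_div_add_atTop_nhds_zero_nat.const_mul 4)
    simpa using this.sqrt

/-- From a decreasing sequence of nonempty convex sets of decision rules one can choose rules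
that converge almost everywhere along a subsequence. -/
theorem exists_tendsto_ae_of_antitone_convex {Y : Type*} [MeasurableSpace Y] (ν : Measure Y)
    [IsFiniteMeasure ν] {C : ℕ → Set (Y → ℝ)} (hC : ∀ n, C n ⊆ decisionRules Y)
    (hne : ∀ n, (C n).Nonempty) (hconv : ∀ n, Convex ℝ (C n)) (hanti : Antitone C) :
    ∃ (d : ℕ → Y → ℝ) (δ : Y → ℝ) (ns : ℕ → ℕ), (∀ n, d n ∈ C n) ∧ δ ∈ decisionRules Y ∧
      StrictMono ns ∧ ∀ᵐ y ∂ν, Tendsto (fun k => d (ns k) y) atTop (𝓝 (δ y)) := by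
  let C' : ℕ → Set (Lp ℝ 2 ν) := fun n => {v | ∃ δ ∈ C n, v =ᵐ[ν] δ}
  have hbound : ∀ δ ∈ decisionRules Y, ∀ y, ‖δ y‖ ≤ 1 := fun δ hδ y => by
    rw [Real.norm_of_nonneg (hδ.2 y).1]; exact (hδ.2 y).2
  have hne' : ∀ n, (C' n).Nonempty := fun n => by
    obtain ⟨δ, hδ⟩ := hne n
    have hmem : MemLp δ 2 ν := MemLp.of_bound (hC n hδ).1.aestronglyMeasurable 1
      (Eventually.of_forall (hbound δ (hC n hδ)))
    exact ⟨hmem.toLp δ, δ, hδ, hmem.coeFn_toLp⟩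
  have hconv' : ∀ n, Convex ℝ (C' n) := fun n => by
    rintro v ⟨δ, hδ, hv⟩ w ⟨δ', hδ', hw⟩ a b ha hb hab
    refine ⟨a • δ + b • δ', hconv n hδ hδ' ha hb hab, ?_⟩
    filter_upwards [hv, hw, Lp.coeFn_add (a • v) (b • w), Lp.coeFn_smul a v, Lp.coeFn_smul b w]
      with y h1 h2 h3 h4 h5
    rw [h3, Pi.add_apply, h4, h5]
    simp [h1, h2]
  have hanti' : Antitone C' := fun n m hnm => by
    rintro v ⟨δ, hδ, hv⟩
    exact ⟨δ, hanti hnm hδ, hv⟩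
  have hbound' : ∀ n, ∀ v ∈ C' n,
      ‖v‖ ≤ (measureUnivNNReal ν : ℝ) ^ (2 : ℝ≥0∞).toReal⁻¹ * 1 := fun n v hv => by
    obtain ⟨δ, hδ, hv⟩ := hv
    refine Lp.norm_le_of_ae_bound zero_le_one ?_
    filter_upwards [hv] with y hy
    rw [hy]
    exact hbound δ (hC n hδ) y
  obtain ⟨v, hv, hcau⟩ := exists_cauchySeq_mem_of_antitone_convex hne' hconv' hanti' hbound'
  choose d hd hvd using hv
  obtain ⟨x, hx⟩ := cauchySeq_tendsto_of_complete hcau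
  obtain ⟨ns, hns, hae⟩ := (tendstoInMeasure_of_tendsto_Lp hx).exists_seq_tendsto_ae
  -- The L² limit has values in [0, 1] only almost everywhere; clipping makes it a rule at every
  -- point.
  refine ⟨d, fun y => max 0 (min 1 (x y)), ns, hd, ⟨?_, fun y => ?_⟩, hns, ?_⟩
  · exact measurable_const.max (measurable_const.min (Lp.stronglyMeasurable x).measurable)
  · exact ⟨le_max_left _ _, max_le zero_le_one (min_le_left _ _)⟩
  · filter_upwards [hae, ae_all_iff.2 hvd] with y hy hy'
    have hclip : Continuous fun t : ℝ => max 0 (min 1 t) := by fun_prop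
    refine ((hclip.tendsto _).comp hy).congr fun k => ?_
    have hmem := (hC _ (hd (ns k))).2 y
    simp only [Function.comp, hy' (ns k), min_eq_right hmem.2, max_eq_right hmem.1]

variable {Θ Y : Type*} [MetricSpace Θ] [CompactSpace Θ] [MeasurableSpace Θ]
  [MeasurableSpace Y] {μ : Measure Y} {f : Θ → Y → ℝ}

/-- The set of power functions of decision rules is compact for uniform convergence. -/
theorem isCompact_powerFunctions [Nonempty Θ] (hf : IsDensityFamily μ f)
    (hcont : IsTVContinuousFamily μ f) :
    IsCompact {q : BoundedContinuousFunction Θ ℝ |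
      ∃ δ ∈ decisionRules Y, ∀ θ, q θ = power μ f δ θ} := by
  set S := {q : BoundedContinuousFunction Θ ℝ | ∃ δ ∈ decisionRules Y, ∀ θ, q θ = power μ f δ θ}
  have hcomp : IsCompact (closure S) := by
    refine BoundedContinuousFunction.arzela_ascoli (Icc (0 : ℝ) 1) isCompact_Icc S ?_ ?_
    · rintro q θ ⟨δ, hδ, hq⟩
      rw [hq]
      exact power_mem_Icc hf hδ θ
    · have hS : ∀ q : S, ∃ δ : decisionRules Y, ⇑(q : BoundedContinuousFunction Θ ℝ)
          = power μ f (δ : Y → ℝ) := by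
        rintro ⟨q, δ, hδ, hq⟩
        exact ⟨⟨δ, hδ⟩, funext hq⟩
      choose D hD using hS
      have := (equicontinuous_power hf hcont).comp D
      convert this using 2 with q
      exact hD q
  have hclosed : IsClosed S := by
    refine isClosed_of_closure_subset fun q hq => ?_
    obtain ⟨θ₀⟩ := ‹Nonempty Θ›
    have := hf.isProbabilityMeasure_law θ₀
    -- Rules whose power approximates `q` uniformly within 1 / (n + 1): nonempty because `q` is in
    -- the closure, convex because power is affine in the rule.
    let C : ℕ → Set (Y → ℝ) := fun n =>
      {δ | δ ∈ decisionRules Y ∧ ∀ θ, |power μ f δ θ - q θ| ≤ 1 / ((n : ℝ) + 1)}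
    have hne : ∀ n, (C n).Nonempty := fun n => by
      obtain ⟨p, ⟨δ, hδ, hp⟩, hlt⟩ :=
        Metric.mem_closure_iff.1 hq _ (Nat.one_div_pos_of_nat (α := ℝ) (n := n))
      refine ⟨δ, hδ, fun θ => ?_⟩
      rw [← hp, abs_sub_comm]
      exact (BoundedContinuousFunction.dist_coe_le_dist θ).trans hlt.le
    have hconv : ∀ n, Convex ℝ (C n) := fun n => by
      rintro δ ⟨hδ, hδq⟩ δ' ⟨hδ', hδq'⟩ a b ha hb hab
      refine ⟨convex_decisionRules hδ hδ' ha hb hab, fun θ => ?_⟩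
      rw [power_smul_add_smul hf hδ hδ']
      exact convex_closedBall (q θ) (1 / ((n : ℝ) + 1)) (hδq θ) (hδq' θ) ha hb hab
    have hanti : Antitone C := fun n m hnm δ hδ =>
      ⟨hδ.1, fun θ => (hδ.2 θ).trans (Nat.one_div_le_one_div hnm)⟩
    obtain ⟨d, δ, ns, hd, hδ, hns, hae⟩ := exists_tendsto_ae_of_antitone_convex (law μ f θ₀)
      (fun n δ (hδ : δ ∈ C n) => hδ.1) hne hconv hanti
    refine ⟨δ, hδ, fun θ => ?_⟩
    -- Almost everywhere convergence under the single law at `θ₀` passes to every other law by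
    -- absolute continuity.
    have h1 : Tendsto (fun k => power μ f (d (ns k)) θ) atTop (𝓝 (power μ f δ θ)) := by
      have := hf.isProbabilityMeasure_law θ
      simp only [power_eq_integral_law hf]
      refine tendsto_integral_of_dominated_convergence (fun _ => 1)
        (fun k => (hd (ns k)).1.1.aestronglyMeasurable) (integrable_const _)
        (fun k => Eventually.of_forall fun y => ?_)
        ((hcont.absolutelyContinuous θ θ₀).ae_le hae)
      rw [Real.norm_of_nonneg ((hd (ns k)).1.2 y).1]
      exact ((hd (ns k)).1.2 y).2
    have h2 : Tendsto (fun n => power μ f (d n) θ) atTop (𝓝 (q θ)) := by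
      rw [tendsto_iff_dist_tendsto_zero]
      exact squeeze_zero (fun _ => dist_nonneg) (fun n => (hd n).2 θ)
        tendsto_one_div_add_atTop_nhds_zero_nat
    exact tendsto_nhds_unique (h2.comp hns.tendsto_atTop) h1
  exact hclosed.closure_eq ▸ hcomp

variable [BorelSpace Θ]

theorem exists_isOptimalRule (hf : IsDensityFamily μ f) (hcont : IsTVContinuousFamily μ f)
    {Θ₀ : Set Θ} (hΘ₀ : Θ₀.Nonempty) (Λ₁ : Measure ↥Θ₀ᶜ) [IsFiniteMeasure Λ₁] {α : ℝ}
    (hα : 0 ≤ α) {g : ℝ → ℝ} (hg : ContinuousOn g (Icc 0 1)) :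
    ∃ δ, IsOptimalRule μ f g Λ₁ α δ := by
  have : Nonempty Θ := hΘ₀.to_type
  -- Extending g by constants beyond [0, 1] makes the objective continuous on all bounded continuous
  -- functions, not just on power functions.
  let G : ℝ → ℝ := IccExtend (zero_le_one (α := ℝ)) ((Icc (0 : ℝ) 1).domRestrict g)
  have hG : Continuous G := hg.domRestrict.Icc_extend'
  have hGg : ∀ t ∈ Icc (0 : ℝ) 1, G t = g t := fun t ht => IccExtend_of_mem _ _ ht
  obtain ⟨M, hM⟩ : ∃ M, ∀ t, ‖G t‖ ≤ M := by
    obtain ⟨M, hM⟩ := isCompact_Icc.exists_bound_of_continuousOn hg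
    exact ⟨M, fun t => hM _ (projIcc 0 1 zero_le_one t).2⟩
  let J : BoundedContinuousFunction Θ ℝ → ℝ := fun q => ∫ θ : ↥Θ₀ᶜ, G (q θ) ∂Λ₁
  have hJ : Continuous J := by
    refine continuous_of_dominated (bound := fun _ => M) (fun q => ?_)
      (fun q => Eventually.of_forall fun θ => hM _) (integrable_const _)
      (Eventually.of_forall fun θ => ?_)
    · exact (hG.comp (q.continuous.comp continuous_subtype_val)).aestronglyMeasurable
    · exact hG.comp (continuous_eval_const (θ : Θ))
  have hJobj : ∀ (q : BoundedContinuousFunction Θ ℝ) (δ : Y → ℝ), δ ∈ decisionRules Y →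
      (∀ θ, q θ = power μ f δ θ) → J q = objective μ f g Λ₁ δ := by
    intro q δ hδ hq
    refine integral_congr_ae (Eventually.of_forall fun θ => ?_)
    simp only [hq]
    exact hGg _ (power_mem_Icc hf hδ θ)
  let toBCF : ∀ δ ∈ decisionRules Y, BoundedContinuousFunction Θ ℝ := fun δ hδ =>
    BoundedContinuousFunction.mkOfCompact ⟨power μ f δ, continuous_power hf hcont hδ⟩
  have hK : IsCompact ({q : BoundedContinuousFunction Θ ℝ |
      ∃ δ ∈ decisionRules Y, ∀ θ, q θ = power μ f δ θ} ∩ {q | ∀ θ ∈ Θ₀, q θ ≤ α}) := by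
    refine (isCompact_powerFunctions hf hcont).inter_right ?_
    simp only [ofPred_forall]
    exact isClosed_biInter fun θ _ =>
      isClosed_le (continuous_eval_const θ) continuous_const
  have h0 : (fun _ => (0 : ℝ)) ∈ decisionRules Y :=
    const_mem_decisionRules (left_mem_Icc.2 zero_le_one)
  obtain ⟨q, ⟨⟨δ, hδ, hq⟩, hqα⟩, hmax⟩ := hK.exists_isMaxOn
    ⟨toBCF _ h0, ⟨_, h0, fun θ => rfl⟩, fun θ _ => (power_const hf 0 θ).trans_le hα⟩
    hJ.continuousOn
  refine ⟨δ, (mem_feasibleRules_iff hf hΘ₀).2 ⟨hδ, fun θ hθ => hq θ ▸ hqα θ hθ⟩,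
    fun δ' hδ' => ?_⟩
  obtain ⟨hδ'r, hδ'α⟩ := (mem_feasibleRules_iff hf hΘ₀).1 hδ'
  rw [← hJobj q δ hδ hq, ← hJobj (toBCF δ' hδ'r) δ' hδ'r fun θ => rfl]
  exact hmax ⟨⟨δ', hδ'r, fun θ => rfl⟩, hδ'α⟩

omit [CompactSpace Θ] in
theorem integrable_comp_power (hf : IsDensityFamily μ f) (hcont : IsTVContinuousFamily μ f)
    {Θ₀ : Set Θ} (Λ₁ : Measure ↥Θ₀ᶜ) [IsFiniteMeasure Λ₁] {g : ℝ → ℝ}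
    (hg : ContinuousOn g (Icc 0 1)) {δ : Y → ℝ} (hδ : δ ∈ decisionRules Y) :
    Integrable (fun θ : ↥Θ₀ᶜ => g (power μ f δ θ)) Λ₁ := by
  obtain ⟨M, hM⟩ := isCompact_Icc.exists_bound_of_continuousOn hg
  refine Integrable.of_bound (C := M) ?_ (Eventually.of_forall fun θ =>
    hM _ (power_mem_Icc hf hδ θ))
  exact (hg.comp_continuous ((continuous_power hf hcont hδ).comp continuous_subtype_val)
    fun θ : ↥Θ₀ᶜ => power_mem_Icc hf hδ (θ : Θ)).aestronglyMeasurable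

/-- For a nondecreasing `g`, an optimal rule can be chosen to exhaust the level `α`. -/
theorem exists_isOptimalRule_iSup_power_eq (hf : IsDensityFamily μ f)
    (hcont : IsTVContinuousFamily μ f) {Θ₀ : Set Θ} (hΘ₀ : Θ₀.Nonempty) (Λ₁ : Measure ↥Θ₀ᶜ)
    [IsFiniteMeasure Λ₁] {α : ℝ} (hα : α ∈ Ioo (0 : ℝ) 1) {g : ℝ → ℝ}
    (hg : ContinuousOn g (Icc 0 1)) (hmono : MonotoneOn g (Icc 0 1)) :
    ∃ δ, IsOptimalRule μ f g Λ₁ α δ ∧ (⨆ θ : Θ₀, power μ f δ θ) = α := by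
  have := hΘ₀.to_subtype
  obtain ⟨δ, ⟨hδ, hδα⟩, hmax⟩ := exists_isOptimalRule hf hcont hΘ₀ Λ₁ hα.1.le hg
  set s := ⨆ θ : Θ₀, power μ f δ θ with hs
  have h1 : (fun _ => (1 : ℝ)) ∈ decisionRules Y :=
    const_mem_decisionRules (right_mem_Icc.2 zero_le_one)
  have hs1 : 0 < 1 - s := by linarith [hα.2]
  -- The solution of (1 - t) s + t = α.
  let t := (α - s) / (1 - s)
  have ht0 : 0 ≤ t := div_nonneg (by linarith) hs1.le
  have ht1 : t ≤ 1 := (div_le_one hs1).2 (by linarith [hα.2])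
  let δ' : Y → ℝ := (1 - t) • δ + t • fun _ => (1 : ℝ)
  have hδ' : δ' ∈ decisionRules Y :=
    convex_decisionRules hδ h1 (by linarith) ht0 (by ring)
  have hp : ∀ θ, power μ f δ' θ = (1 - t) * power μ f δ θ + t := fun θ => by
    rw [power_smul_add_smul hf hδ h1, power_const hf, mul_one]
  have hsup : (⨆ θ : Θ₀, power μ f δ' θ) = α := by
    simp only [hp]
    have hm : Monotone fun x : ℝ => (1 - t) * x + t := fun x y hxy => by
      have := mul_le_mul_of_nonneg_left hxy (sub_nonneg.2 ht1)
      simpa using this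
    have := hm.map_ciSup_of_continuousAt (by fun_prop) (bddAbove_range_power hf hδ Θ₀)
    rw [← this, ← hs]
    have : t * (1 - s) = α - s := div_mul_cancel₀ _ hs1.ne'
    linarith
  refine ⟨δ', ⟨⟨hδ', hsup.le⟩, fun δ'' hδ'' => (hmax δ'' hδ'').trans ?_⟩, hsup⟩
  refine integral_mono (integrable_comp_power hf hcont Λ₁ hg hδ)
    (integrable_comp_power hf hcont Λ₁ hg hδ') fun θ => ?_
  refine hmono (power_mem_Icc hf hδ θ) (power_mem_Icc hf hδ' θ) ?_
  rw [hp]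
  nlinarith [(power_mem_Icc hf hδ θ).2]

end Compactness

/-! ### First-order condition at an optimal rule -/

section FirstOrder

variable {Θ Y : Type*} [MetricSpace Θ] [CompactSpace Θ] [MeasurableSpace Θ]
  [MeasurableSpace Y] {μ : Measure Y} {f : Θ → Y → ℝ}

/-- The values of a power function that avoids `0` and `1` stay away from `0` and `1`. -/
theorem exists_power_mem_Icc_of_mem_Ioo [Nonempty Θ] (hf : IsDensityFamily μ f)
    (hcont : IsTVContinuousFamily μ f) {δ : Y → ℝ} (hδ : δ ∈ decisionRules Y)
    (hδ' : ∀ θ, power μ f δ θ ∈ Ioo (0 : ℝ) 1) :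
    ∃ η > 0, ∀ θ, power μ f δ θ ∈ Icc η (1 - η) := by
  have hc := continuous_power hf hcont hδ
  obtain ⟨a, -, ha⟩ := isCompact_univ.exists_isMinOn univ_nonempty hc.continuousOn
  obtain ⟨b, -, hb⟩ := isCompact_univ.exists_isMaxOn univ_nonempty hc.continuousOn
  refine ⟨min (power μ f δ a) (1 - power μ f δ b), lt_min (hδ' a).1 (by linarith [(hδ' b).2]),
    fun θ => ⟨(min_le_left _ _).trans (ha (mem_univ θ)), ?_⟩⟩
  have h1 : power μ f δ θ ≤ power μ f δ b := hb (mem_univ θ)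
  linarith [min_le_right (power μ f δ a) (1 - power μ f δ b)]

/-- First-order condition: an optimal rule is also optimal for the linearized objective. -/
theorem IsOptimalRule.integral_deriv_mul_le [BorelSpace Θ] [Nonempty Θ] (hf : IsDensityFamily μ f)
    (hcont : IsTVContinuousFamily μ f) {Θ₀ : Set Θ} (hΘ₀ : Θ₀.Nonempty) {Λ₁ : Measure ↥Θ₀ᶜ}
    [IsFiniteMeasure Λ₁] {α : ℝ} {g : ℝ → ℝ} (hg : ContDiffOn ℝ 1 g (Ioo 0 1)) {δ δ' : Y → ℝ}
    (hδ : IsOptimalRule μ f g Λ₁ α δ) (hint : ∀ θ, power μ f δ θ ∈ Ioo (0 : ℝ) 1)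
    (hδ' : δ' ∈ feasibleRules μ f Θ₀ α) :
    ∫ θ : ↥Θ₀ᶜ, deriv g (power μ f δ θ) * (power μ f δ' θ - power μ f δ θ) ∂Λ₁ ≤ 0 := by
  obtain ⟨hfeas, hmax⟩ := hδ
  obtain ⟨hr, hα⟩ := (mem_feasibleRules_iff hf hΘ₀).1 hfeas
  obtain ⟨hr', hα'⟩ := (mem_feasibleRules_iff hf hΘ₀).1 hδ'
  obtain ⟨η, hη, hpη⟩ := exists_power_mem_Icc_of_mem_Ioo hf hcont hr hint
  have hcp := continuous_power hf hcont hr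
  have hcp' := continuous_power hf hcont hr'
  -- Differentiating under the integral needs ε of both signs, although only ε ≥ 0 gives rules. For
  -- |ε| < η / 2 the perturbed values stay in this interval, where g' is bounded.
  have hsub : Icc (η / 2) (1 - η / 2) ⊆ Ioo (0 : ℝ) 1 := fun t ht =>
    ⟨by linarith [ht.1], by linarith [ht.2]⟩
  have hderiv : ContinuousOn (deriv g) (Ioo 0 1) := hg.continuousOn_deriv_of_isOpen isOpen_Ioo le_rfl
  have hdiff : ∀ t ∈ Ioo (0 : ℝ) 1, HasDerivAt g (deriv g t) t := fun t ht =>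
    ((hg.differentiableOn one_ne_zero).differentiableAt (isOpen_Ioo.mem_nhds ht)).hasDerivAt
  obtain ⟨M, hM⟩ := isCompact_Icc.exists_bound_of_continuousOn (hderiv.mono hsub)
  have hdist : ∀ θ, |power μ f δ' θ - power μ f δ θ| ≤ 1 := fun θ => by
    have h1 := power_mem_Icc hf hr θ
    have h2 := power_mem_Icc hf hr' θ
    rw [abs_le]
    constructor <;> linarith [h1.1, h1.2, h2.1, h2.2]
  have hstay : ∀ ε ∈ Metric.ball (0 : ℝ) (η / 2), ∀ θ,
      power μ f δ θ + ε * (power μ f δ' θ - power μ f δ θ) ∈ Icc (η / 2) (1 - η / 2) := by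
    intro ε hε θ
    rw [Metric.mem_ball, dist_zero_right, Real.norm_eq_abs] at hε
    have h1 : |ε * (power μ f δ' θ - power μ f δ θ)| ≤ η / 2 := by
      rw [abs_mul]
      exact (mul_le_of_le_one_right (abs_nonneg _) (hdist θ)).trans hε.le
    rw [abs_le] at h1
    have h2 := hpη θ
    constructor <;> linarith [h1.1, h1.2, h2.1, h2.2]
  let F : ℝ → ↥Θ₀ᶜ → ℝ := fun ε θ =>
    g (power μ f δ θ + ε * (power μ f δ' θ - power μ f δ θ))
  have hFc : ∀ ε ∈ Metric.ball (0 : ℝ) (η / 2), Continuous (F ε) := fun ε hε =>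
    (hg.continuousOn.mono hsub).comp_continuous (by fun_prop) fun θ => hstay ε hε θ
  have hball : Metric.ball (0 : ℝ) (η / 2) ∈ 𝓝 (0 : ℝ) := Metric.ball_mem_nhds _ (by positivity)
  have h0 : (0 : ℝ) ∈ Metric.ball (0 : ℝ) (η / 2) := Metric.mem_ball_self (by positivity)
  have key := (hasDerivAt_integral_of_dominated_loc_of_deriv_le (μ := Λ₁) (F := F)
    (bound := fun _ => M) (F' := fun ε θ =>
      deriv g (power μ f δ θ + ε * (power μ f δ' θ - power μ f δ θ))
        * (power μ f δ' θ - power μ f δ θ)) hball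
    (by filter_upwards [hball] with ε hε using (hFc ε hε).aestronglyMeasurable)
    ?_ ?_ ?_ (integrable_const M) ?_).2
  · simp only [zero_mul, add_zero] at key
    -- The right slopes are nonpositive: for 0 < ε < 1 the mixture of the two rules is feasible, so
    -- it cannot beat δ.
    refine le_of_tendsto key.tendsto_slope_zero_right ?_
    filter_upwards [Ioo_mem_nhdsGT (zero_lt_one (α := ℝ))] with ε hε
    rw [smul_eq_mul]
    refine mul_nonpos_of_nonneg_of_nonpos (inv_nonneg.2 hε.1.le) (sub_nonpos.2 ?_)
    have hmix : (1 - ε) • δ + ε • δ' ∈ feasibleRules μ f Θ₀ α := by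
      refine (mem_feasibleRules_iff hf hΘ₀).2
        ⟨convex_decisionRules hr hr' (by linarith [hε.2]) hε.1.le (by ring), fun θ hθ => ?_⟩
      rw [power_smul_add_smul hf hr hr']
      nlinarith [hα θ hθ, hα' θ hθ, hε.1, hε.2]
    have := hmax _ hmix
    have hcomb : ∀ a b : ℝ, (1 - ε) * a + ε * b = a + ε * (b - a) := fun a b => by ring
    simp only [objective, power_smul_add_smul hf hr hr', hcomb] at this
    simpa only [F, zero_mul, add_zero, zero_add] using this
  · exact Integrable.of_bound (hFc 0 h0).aestronglyMeasurable
      (isCompact_Icc.exists_bound_of_continuousOn (hg.continuousOn.mono hsub)).choose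
      (Eventually.of_forall fun θ =>
        (isCompact_Icc.exists_bound_of_continuousOn (hg.continuousOn.mono hsub)).choose_spec _
          (hstay 0 h0 θ))
  · refine Continuous.aestronglyMeasurable (Continuous.mul ?_ (by fun_prop))
    exact (hderiv.mono hsub).comp_continuous (by fun_prop) fun θ => hstay 0 h0 θ
  · refine Eventually.of_forall fun θ ε hε => ?_
    rw [norm_mul]
    exact (mul_le_of_le_one_right (norm_nonneg _) (hdist θ)).trans (hM _ (hstay ε hε θ))
  · refine Eventually.of_forall fun θ ε hε => ?_
    have hin : HasDerivAt (fun ε : ℝ =>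
        power μ f δ θ + ε * (power μ f δ' θ - power μ f δ θ))
        (power μ f δ' θ - power μ f δ θ) ε := by
      simpa using ((hasDerivAt_id ε).mul_const
        (power μ f δ' θ - power μ f δ θ)).const_add (power μ f δ θ)
    exact (hdiff _ (hsub (hstay ε hε θ))).comp ε hin

end FirstOrder

/-! ### Lagrange multipliers by separation and Riesz representation -/

section Multiplier

variable {X : Type*} [TopologicalSpace X] [CompactSpace X]

/-- A positive linear functional on the continuous functions on a compact space is integration
against a finite measure. -/
theorem exists_finiteMeasure_of_nonneg [T2Space X] [MeasurableSpace X] [BorelSpace X]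
    (φ : C(X, ℝ) →ₗ[ℝ] ℝ) (hφ : ∀ h : C(X, ℝ), 0 ≤ h → 0 ≤ φ h) :
    ∃ ν : Measure X, IsFiniteMeasure ν ∧ ∀ h : C(X, ℝ), ∫ x, h x ∂ν = φ h := by
  -- On a compact space every continuous function is compactly supported, so `φ` transfers to the
  -- setting of the Riesz theorem.
  let ψ : CompactlySupportedContinuousMap X ℝ →ₗ[ℝ] ℝ :=
    { toFun := fun h => φ h.toContinuousMap
      map_add' := fun a b => by rw [← map_add]; rfl
      map_smul' := fun c a => by
        rw [RingHom.id_apply, ← map_smul]; rfl }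
  let Λ := PositiveLinearMap.mk₀ ψ (fun h hh => hφ h.toContinuousMap hh)
  refine ⟨RealRMK.rieszMeasure Λ, inferInstance, fun h => ?_⟩
  exact RealRMK.integral_rieszMeasure Λ (CompactlySupportedContinuousMap.continuousMapEquiv h)

/-- Lagrange multipliers for a family of constraints indexed by a compact space: if `r₀` is the
maximum of `r` over the pairs `(h, r) ∈ B` with `h < 0`, and if some pair of `B` satisfies this
strict constraint, then the constraint can be replaced by a linear penalty. -/
theorem exists_multiplier {B : Set (C(X, ℝ) × ℝ)} (hB : Convex ℝ B) (r₀ : ℝ)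
    (hslater : ∃ b ∈ B, ∀ x, b.1 x < 0)
    (hopt : ∀ b ∈ B, (∀ x, b.1 x < 0) → b.2 ≤ r₀) :
    ∃ φ : C(X, ℝ) →ₗ[ℝ] ℝ, (∀ h, 0 ≤ h → 0 ≤ φ h) ∧ ∀ b ∈ B, b.2 ≤ r₀ + φ b.1 := by
  -- Strictly feasible pairs with a value above `r₀`: open because both conditions are strict and X
  -- is compact, disjoint from `B` by `hopt`.
  let A : Set (C(X, ℝ) × ℝ) := {a | (∀ x, a.1 x < 0) ∧ r₀ < a.2}
  have hAo : IsOpen A := by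
    refine IsOpen.inter (?_ : IsOpen {a : C(X, ℝ) × ℝ | ∀ x, a.1 x < 0})
      (isOpen_lt continuous_const continuous_snd)
    have h := (ContinuousMap.isOpen_setOfPred_mapsTo (X := X) (Y := ℝ) isCompact_univ
      (isOpen_Iio (a := 0))).preimage (continuous_fst (X := C(X, ℝ)) (Y := ℝ))
    convert h using 1
    ext a
    simp [MapsTo]
  have hAc : Convex ℝ A := by
    rintro ⟨h, r⟩ ⟨hh, hr⟩ ⟨h', r'⟩ ⟨hh', hr'⟩ a b ha hb hab
    refine ⟨fun x => ?_, ?_⟩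
    · exact convex_Iio (0 : ℝ) (hh x) (hh' x) ha hb hab
    · exact convex_Ioi r₀ hr hr' ha hb hab
  obtain ⟨F, u, hFA, hFB⟩ := geometric_hahn_banach_open hAc hAo hB (by
    rw [Set.disjoint_left]
    rintro b ⟨hb, hb'⟩ hbB
    exact absurd (hopt b hbB hb) (not_le.2 hb'))
  have hsplit : ∀ (h : C(X, ℝ)) (r : ℝ), F (h, r) = F (h, 0) + r * F (0, 1) := by
    intro h r
    rw [← smul_eq_mul, ← map_smul, ← map_add]
    simp
  have hadd : ∀ h h' : C(X, ℝ), F (h + h', 0) = F (h, 0) + F (h', 0) := fun h h' => by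
    rw [← map_add]; simp
  have hsmul : ∀ (c : ℝ) (h : C(X, ℝ)), F (c • h, 0) = c * F (h, 0) := fun c h => by
    rw [← smul_eq_mul, ← map_smul]; simp
  set ρ := F (0, 1) with hρ
  -- `A` is stable under scaling h by t > 0 and under raising the value; letting s or t tend to 0 or
  -- ∞ yields the signs and the bound on u below.
  have hneg : ∀ h : C(X, ℝ), (∀ x, h x < 0) → ∀ s > 0, ∀ t > 0,
      t * F (h, 0) + (r₀ + s) * ρ < u := by
    intro h hh s hs t ht
    rw [← hsmul, ← hsplit]
    refine hFA _ ⟨fun x => ?_, by simpa using hs⟩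
    simpa using mul_neg_of_pos_of_neg ht (hh x)
  let one : C(X, ℝ) := ContinuousMap.const X 1
  have hm1 : ∀ x, (-one) x < 0 := fun x => by simp [one]
  have hφneg : ∀ h : C(X, ℝ), (∀ x, h x < 0) → F (h, 0) ≤ 0 := by
    intro h hh
    by_contra! hpos
    have hlim : Tendsto (fun t : ℝ => t * F (h, 0) + (r₀ + 1) * ρ) atTop atTop :=
      tendsto_atTop_add_const_right _ _ (tendsto_id.atTop_mul_const hpos)
    obtain ⟨t, ht, ht'⟩ := ((hlim.eventually_gt_atTop u).and (eventually_gt_atTop 0)).exists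
    exact absurd (hneg h hh 1 one_pos t ht') (not_lt.2 ht.le)
  have hφpos : ∀ h : C(X, ℝ), 0 ≤ h → 0 ≤ F (h, 0) := by
    intro h hh
    have hε : ∀ ε > 0, 0 ≤ F (h, 0) + ε * F (one, 0) := by
      intro ε hε
      have := hφneg (-(h + ε • one)) fun x => by
        have : 0 ≤ h x := hh x
        simp [one]
        linarith
      have h2 := hsmul (-1) (h + ε • one)
      rw [neg_smul, one_smul, hadd, hsmul] at h2
      linarith
    have hlim : Tendsto (fun ε : ℝ => F (h, 0) + ε * F (one, 0)) (𝓝[>] 0)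
        (𝓝 (F (h, 0) + 0 * F (one, 0))) :=
      ((continuous_const.add (continuous_id.mul continuous_const)).tendsto 0).mono_left
        nhdsWithin_le_nhds
    rw [zero_mul, add_zero] at hlim
    exact ge_of_tendsto hlim (eventually_nhdsWithin_of_forall hε)
  have hu : r₀ * ρ ≤ u := by
    have hlim : Tendsto (fun t : ℝ => t * F (-one, 0) + (r₀ + t) * ρ) (𝓝[>] 0)
        (𝓝 (0 * F (-one, 0) + (r₀ + 0) * ρ)) :=
      (((continuous_id.mul continuous_const).add
        ((continuous_const.add continuous_id).mul continuous_const)).tendsto 0).mono_left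
        nhdsWithin_le_nhds
    rw [zero_mul, zero_add, add_zero] at hlim
    exact le_of_tendsto hlim (eventually_nhdsWithin_of_forall
      fun t (ht : 0 < t) => (hneg _ hm1 t ht t ht).le)
  have hρ0 : ρ ≤ 0 := by
    by_contra! hpos
    have hlim : Tendsto (fun s : ℝ => 1 * F (-one, 0) + (r₀ + s) * ρ) atTop atTop :=
      tendsto_atTop_add_const_left _ _
        ((tendsto_atTop_add_const_left _ _ tendsto_id).atTop_mul_const hpos)
    obtain ⟨s, hs, hs'⟩ := ((hlim.eventually_gt_atTop u).and (eventually_gt_atTop 0)).exists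
    exact absurd (hneg _ hm1 s hs' 1 one_pos) (not_lt.2 hs.le)
  have hBineq : ∀ b ∈ B, r₀ * ρ ≤ F (b.1, 0) + b.2 * ρ := fun b hb => by
    rw [← hsplit]; exact hu.trans (hFB b hb)
  -- If ρ were 0, the Slater pair would give F (b.1, 0) < u from the side of `A` and ≥ u from the
  -- side of `B`.
  have hρneg : ρ < 0 := by
    refine hρ0.lt_of_ne fun h0 => ?_
    obtain ⟨b, hb, hb'⟩ := hslater
    have h1 := hneg b.1 hb' 1 one_pos 1 one_pos
    have h2 := hFB b hb
    rw [show b = (b.1, b.2) from rfl, hsplit] at h2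
    rw [h0] at h1 h2
    simp only [mul_zero, add_zero, one_mul] at h1 h2
    linarith
  refine ⟨⟨⟨fun h => (-ρ)⁻¹ * F (h, 0), fun h h' => by rw [hadd, mul_add]⟩,
    fun c h => by simp only [hsmul, RingHom.id_apply, smul_eq_mul]; ring⟩, fun h hh => ?_,
    fun b hb => ?_⟩
  · exact mul_nonneg (inv_nonneg.2 (by linarith)) (hφpos h hh)
  · have hpos : 0 < -ρ := by linarith
    change b.2 ≤ r₀ + (-ρ)⁻¹ * F (b.1, 0)
    rw [← sub_le_iff_le_add', inv_mul_eq_div, le_div_iff₀ hpos]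
    linarith [hBineq b hb]

end Multiplier

/-! ### Neyman–Pearson form of a maximizer -/

section NeymanPearson

variable {Y : Type*} [MeasurableSpace Y] {μ : Measure Y}

/-- A rule that maximizes `∫ δ (H - K) dμ` coincides almost everywhere with a rule that rejects
where `H > K` and accepts where `H < K`. -/
theorem exists_ae_eq_likelihoodRatioRule {H K : Y → ℝ≥0∞} (hH : Measurable H) (hK : Measurable K)
    (hHfin : ∫⁻ y, H y ∂μ ≠ ∞) (hKfin : ∫⁻ y, K y ∂μ ≠ ∞) {δ : Y → ℝ} (hδ : δ ∈ decisionRules Y)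
    (hopt : ∀ δ' ∈ decisionRules Y,
      ∫⁻ y, ENNReal.ofReal (δ' y) * H y ∂μ + ∫⁻ y, ENNReal.ofReal (δ y) * K y ∂μ
        ≤ ∫⁻ y, ENNReal.ofReal (δ y) * H y ∂μ + ∫⁻ y, ENNReal.ofReal (δ' y) * K y ∂μ) :
    ∃ δ' ∈ decisionRules Y, δ' =ᵐ[μ] δ ∧
      ∀ y, (K y < H y → δ' y = 1) ∧ (H y < K y → δ' y = 0) := by
  classical
  -- A pointwise maximizer of δ (H - K) that keeps δ on ties.
  let δ' : Y → ℝ := fun y => if K y < H y then 1 else if H y < K y then 0 else δ y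
  have hgt : ∀ y, K y < H y → δ' y = 1 := fun y hy => by simp [δ', hy]
  have hlt : ∀ y, H y < K y → δ' y = 0 := fun y hy => by simp [δ', hy, not_lt.2 hy.le]
  have heq : ∀ y, H y = K y → δ' y = δ y := fun y hy => by simp [δ', hy]
  have hδ' : δ' ∈ decisionRules Y := by
    refine ⟨Measurable.ite (measurableSet_lt hK hH) measurable_const
      (Measurable.ite (measurableSet_lt hH hK) measurable_const hδ.1), fun y => ?_⟩
    rcases lt_trichotomy (H y) (K y) with h | h | h
    · rw [hlt y h]; exact left_mem_Icc.2 zero_le_one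
    · rw [heq y h]; exact hδ.2 y
    · rw [hgt y h]; exact right_mem_Icc.2 zero_le_one
  refine ⟨δ', hδ', ?_, fun y => ⟨hgt y, hlt y⟩⟩
  have hmul : ∀ d ∈ decisionRules Y, ∀ G : Y → ℝ≥0∞, Measurable G →
      Measurable fun y => ENNReal.ofReal (d y) * G y := fun d hd G hG =>
    hd.1.ennreal_ofReal.mul hG
  have hle1 : ∀ d ∈ decisionRules Y, ∀ y (c : ℝ≥0∞), ENNReal.ofReal (d y) * c ≤ c :=
    fun d hd y c => mul_le_of_le_one_left' (ENNReal.ofReal_le_one.2 (hd.2 y).2)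
  have hHf := ae_lt_top hH hHfin
  have hKf := ae_lt_top hK hKfin
  have hreal : ∀ y, H y < ∞ → K y < ∞ →
      ENNReal.ofReal (δ y) * H y + ENNReal.ofReal (δ' y) * K y
        = ENNReal.ofReal (δ y * (H y).toReal + δ' y * (K y).toReal) ∧
      ENNReal.ofReal (δ' y) * H y + ENNReal.ofReal (δ y) * K y
        = ENNReal.ofReal (δ' y * (H y).toReal + δ y * (K y).toReal) := by
    intro y h1 h2
    have e1 := (hδ.2 y).1
    have e2 := (hδ'.2 y).1
    constructor
    all_goals
      rw [ENNReal.ofReal_add (by positivity) (by positivity), ENNReal.ofReal_mul (by assumption),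
        ENNReal.ofReal_mul (by assumption), ENNReal.ofReal_toReal h1.ne,
        ENNReal.ofReal_toReal h2.ne]
  -- The integrands are ordered pointwise in favor of δ' and the integrals in favor of δ, so they
  -- agree almost everywhere, i.e. (δ' - δ)(H - K) = 0. Sums stand in for differences, as the values
  -- lie in [0, ∞].
  have hae := ae_eq_of_ae_le_of_lintegral_le (μ := μ)
    (f := fun y => ENNReal.ofReal (δ y) * H y + ENNReal.ofReal (δ' y) * K y)
    (g := fun y => ENNReal.ofReal (δ' y) * H y + ENNReal.ofReal (δ y) * K y) ?_ ?_ ?_ ?_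
  · filter_upwards [hae, hHf, hKf] with y hy h1 h2
    rw [(hreal y h1 h2).1, (hreal y h1 h2).2] at hy
    have e1 := (hδ.2 y).1
    have e2 := (hδ'.2 y).1
    rw [ENNReal.ofReal_eq_ofReal_iff (by positivity) (by positivity)] at hy
    have hprod : (δ' y - δ y) * ((H y).toReal - (K y).toReal) = 0 := by linarith
    rcases mul_eq_zero.1 hprod with h | h
    · linarith
    · exact heq y ((ENNReal.toReal_eq_toReal_iff' h1.ne h2.ne).1 (by linarith))
  · filter_upwards [hHf, hKf] with y h1 h2
    rw [(hreal y h1 h2).1, (hreal y h1 h2).2]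
    refine ENNReal.ofReal_le_ofReal ?_
    have e := hδ.2 y
    rcases lt_trichotomy (H y) (K y) with h | h | h
    · rw [hlt y h]
      have := (ENNReal.toReal_lt_toReal h1.ne h2.ne).2 h
      nlinarith [e.1]
    · rw [heq y h]
    · rw [hgt y h]
      have := (ENNReal.toReal_lt_toReal h2.ne h1.ne).2 h
      nlinarith [e.2]
  · rw [lintegral_add_left (hmul δ hδ H hH)]
    exact ENNReal.add_ne_top.2
      ⟨ne_top_of_le_ne_top hHfin (lintegral_mono fun y => hle1 δ hδ y _),
        ne_top_of_le_ne_top hKfin (lintegral_mono fun y => hle1 δ' hδ' y _)⟩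
  · exact ((hmul δ' hδ' H hH).add (hmul δ hδ K hK)).aemeasurable
  · rw [lintegral_add_left (hmul δ hδ H hH), lintegral_add_left (hmul δ' hδ' H hH)]
    exact hopt δ' hδ'

end NeymanPearson

/-! ### The multiplier on the null hypothesis and the main theorem -/

section Main

variable {Θ Y : Type*} [MetricSpace Θ] [CompactSpace Θ] [MeasurableSpace Θ] [BorelSpace Θ]
  [MeasurableSpace Y] {μ : Measure Y} {f : Θ → Y → ℝ}

theorem integrable_mul_power (hf : IsDensityFamily μ f) (hcont : IsTVContinuousFamily μ f)
    {T : Set Θ} (ν : Measure T) [IsFiniteMeasure ν] {w : Θ → ℝ} (hw : Continuous w)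
    {δ : Y → ℝ} (hδ : δ ∈ decisionRules Y) :
    Integrable (fun θ : T => w θ * power μ f δ θ) ν := by
  have hc : Continuous fun θ => w θ * power μ f δ θ := hw.mul (continuous_power hf hcont hδ)
  obtain ⟨M, hM⟩ := isCompact_univ.exists_bound_of_continuousOn hc.continuousOn
  exact Integrable.of_bound (hc.comp continuous_subtype_val).aestronglyMeasurable M
    (Eventually.of_forall fun θ => hM θ (mem_univ _))

theorem integrable_power (hf : IsDensityFamily μ f) (hcont : IsTVContinuousFamily μ f)
    {T : Set Θ} (ν : Measure T) [IsFiniteMeasure ν] {δ : Y → ℝ} (hδ : δ ∈ decisionRules Y) :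
    Integrable (fun θ : T => power μ f δ θ) ν := by
  simpa using integrable_mul_power hf hcont ν (w := fun _ => 1) continuous_const hδ

theorem lintegral_mul_mixedNull [SigmaFinite μ] (hf : IsDensityFamily μ f)
    (hcont : IsTVContinuousFamily μ f) {Θ₀ : Set Θ} (Λ₀ : Measure Θ₀) [IsFiniteMeasure Λ₀]
    {δ : Y → ℝ} (hδ : δ ∈ decisionRules Y) :
    ∫⁻ y, ENNReal.ofReal (δ y) * mixedNull f Λ₀ y ∂μ
      = ENNReal.ofReal (∫ θ : Θ₀, power μ f δ θ ∂Λ₀) := by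
  have h := lintegral_mul_mixture hf hδ Λ₀ measurable_subtype_coe
    (w := fun _ => 1) measurable_const
  simp only [one_mul] at h
  rw [ofReal_integral_eq_lintegral_ofReal (integrable_power hf hcont Λ₀ hδ)
    (Eventually.of_forall fun θ => power_nonneg hf hδ θ), ← h]
  rfl

theorem lintegral_mul_weighted [SigmaFinite μ] (hf : IsDensityFamily μ f)
    (hcont : IsTVContinuousFamily μ f) {T : Set Θ} (ν : Measure T) [IsFiniteMeasure ν]
    {w : Θ → ℝ} (hw : Continuous w) (hw0 : ∀ θ, 0 ≤ w θ) {δ : Y → ℝ} (hδ : δ ∈ decisionRules Y) :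
    ∫⁻ y, ENNReal.ofReal (δ y) * ∫⁻ θ : T, ENNReal.ofReal (w θ * f θ y) ∂ν ∂μ
      = ENNReal.ofReal (∫ θ : T, w θ * power μ f δ θ ∂ν) := by
  rw [ofReal_integral_eq_lintegral_ofReal (integrable_mul_power hf hcont ν hw hδ)
    (Eventually.of_forall fun θ => mul_nonneg (hw0 θ) (power_nonneg hf hδ θ))]
  have h := lintegral_mul_mixture hf hδ ν measurable_subtype_coe
    (w := fun θ => ENNReal.ofReal (w θ))
    (hw.measurable.comp measurable_subtype_coe).ennreal_ofReal
  simp only [← ENNReal.ofReal_mul (hw0 _)] at h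
  exact h

/-- Lagrange multipliers for the worst-case level constraint: a rule that maximizes the linear
functional `∫ w(θ) p(θ; δ) Λ₁(dθ)` under the constraint maximizes a penalized functional without
constraint. -/
theorem exists_null_multiplier (hf : IsDensityFamily μ f) (hcont : IsTVContinuousFamily μ f)
    {Θ₀ : Set Θ} (hΘ₀ : Θ₀.Nonempty) (hclosed : IsClosed Θ₀) (Λ₁ : Measure ↥Θ₀ᶜ)
    [IsProbabilityMeasure Λ₁] {α : ℝ} (hα : 0 < α) {w : Θ → ℝ} (hw : Continuous w)
    (hw0 : ∀ θ, 0 < w θ) {δ : Y → ℝ} (hδ : δ ∈ feasibleRules μ f Θ₀ α)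
    (hlt : ∀ θ, power μ f δ θ < 1)
    (hopt : ∀ δ' ∈ feasibleRules μ f Θ₀ α, ∫ θ : ↥Θ₀ᶜ, w θ * power μ f δ' θ ∂Λ₁
      ≤ ∫ θ : ↥Θ₀ᶜ, w θ * power μ f δ θ ∂Λ₁) :
    ∃ (κ : ℝ≥0) (Λ₀ : Measure Θ₀), IsProbabilityMeasure Λ₀ ∧
      ∫ θ : Θ₀, power μ f δ θ ∂Λ₀ = α ∧
      ∀ δ' ∈ decisionRules Y, ∫ θ : ↥Θ₀ᶜ, w θ * power μ f δ' θ ∂Λ₁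
        ≤ ∫ θ : ↥Θ₀ᶜ, w θ * power μ f δ θ ∂Λ₁ + κ * (∫ θ : Θ₀, power μ f δ' θ ∂Λ₀ - α) := by
  have : CompactSpace Θ₀ := isCompact_iff_compactSpace.1 hclosed.isCompact
  obtain ⟨hr, hrα⟩ := (mem_feasibleRules_iff hf hΘ₀).1 hδ
  let L : (Y → ℝ) → ℝ := fun d => ∫ θ : ↥Θ₀ᶜ, w θ * power μ f d θ ∂Λ₁
  let slack : ∀ d ∈ decisionRules Y, C(Θ₀, ℝ) := fun d hd =>
    ⟨fun θ => power μ f d θ - α,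
      ((continuous_power hf hcont hd).comp continuous_subtype_val).sub continuous_const⟩
  let B : Set (C(Θ₀, ℝ) × ℝ) := {b | ∃ d, ∃ hd : d ∈ decisionRules Y, b = (slack d hd, L d)}
  have hB : Convex ℝ B := by
    rintro _ ⟨d, hd, rfl⟩ _ ⟨d', hd', rfl⟩ a b ha hb hab
    refine ⟨a • d + b • d', convex_decisionRules hd hd' ha hb hab, Prod.ext ?_ ?_⟩
    · ext θ
      change a * (power μ f d θ - α) + b * (power μ f d' θ - α)
        = power μ f (a • d + b • d') θ - α
      rw [power_smul_add_smul hf hd hd']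
      linear_combination (-α) * hab
    · change a * L d + b * L d' = L (a • d + b • d')
      simp only [L, power_smul_add_smul hf hd hd']
      rw [← integral_const_mul, ← integral_const_mul, ← integral_add
        ((integrable_mul_power hf hcont Λ₁ hw hd).const_mul a)
        ((integrable_mul_power hf hcont Λ₁ hw hd').const_mul b)]
      exact integral_congr_ae (Eventually.of_forall fun θ => by ring)
  have h0 : (fun _ => (0 : ℝ)) ∈ decisionRules Y :=
    const_mem_decisionRules (left_mem_Icc.2 zero_le_one)
  have h1 : (fun _ => (1 : ℝ)) ∈ decisionRules Y :=
    const_mem_decisionRules (right_mem_Icc.2 zero_le_one)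
  -- The Slater point is the rule 0, whose slack is -α < 0.
  obtain ⟨φ, hφ0, hφ⟩ := exists_multiplier hB (L δ) ⟨_, ⟨_, h0, rfl⟩, fun θ => by
      change power μ f (fun _ => 0) θ - α < 0
      rw [power_const hf]
      linarith⟩ (by
    rintro _ ⟨d, hd, rfl⟩ hneg
    refine hopt d ((mem_feasibleRules_iff hf hΘ₀).2 ⟨hd, fun θ hθ => ?_⟩)
    have : power μ f d θ - α < 0 := hneg ⟨θ, hθ⟩
    linarith)
  obtain ⟨ν, hν, hνφ⟩ := exists_finiteMeasure_of_nonneg φ hφ0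
  have hpen : ∀ d ∈ decisionRules Y, L d ≤ L δ + ∫ θ : Θ₀, (power μ f d θ - α) ∂ν := by
    intro d hd
    have h := hφ _ ⟨d, hd, rfl⟩
    rwa [← hνφ] at h
  -- Complementary slackness: the integral is ≤ 0 by feasibility of δ and ≥ 0 by the penalized
  -- inequality at δ itself.
  have hslack : ∫ θ : Θ₀, (power μ f δ θ - α) ∂ν = 0 := by
    refine le_antisymm (integral_nonpos fun θ => sub_nonpos.2 (hrα θ θ.2)) ?_
    linarith [hpen δ hr]
  -- Without a penalty δ would be at least as good as the rule 1, which is strictly better because w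
  -- > 0, the power of δ is below 1 and Λ₁ is nonzero.
  have hν0 : ν ≠ 0 := by
    rintro rfl
    have h := hpen _ h1
    rw [integral_zero_measure, add_zero] at h
    simp only [L, power_const hf] at h
    have hi := integrable_mul_power hf hcont Λ₁ hw hr
    have hi1 := integrable_mul_power hf hcont Λ₁ hw h1
    simp only [power_const hf] at hi1
    rw [← sub_nonpos, ← integral_sub hi1 hi] at h
    have hpos : ∀ θ : ↥Θ₀ᶜ, 0 < w θ * 1 - w θ * power μ f δ θ := fun θ => by
      nlinarith [hw0 θ, hlt θ]
    refine absurd ((integral_pos_iff_support_of_nonneg (fun θ => (hpos θ).le)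
      (hi1.sub hi)).2 ?_) (not_lt.2 h)
    rw [Function.support_eq_univ fun θ => (hpos θ).ne', measure_univ]
    exact zero_lt_one
  have hκ0 : ν univ ≠ 0 := by simpa using hν0
  have : NeZero ν := ⟨hν0⟩
  -- κ is the total mass of ν, and Λ₀ is ν normalized.
  have hscale : ∀ h : Θ₀ → ℝ,
      ∫ θ, h θ ∂ν = (ν univ).toNNReal * ∫ θ, h θ ∂((ν univ)⁻¹ • ν) := by
    intro h
    rw [integral_smul_measure, ENNReal.toReal_inv, smul_eq_mul, ← mul_assoc]
    rw [show (((ν univ).toNNReal : ℝ≥0) : ℝ) = (ν univ).toReal from rfl, mul_inv_cancel₀, one_mul]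
    exact (ENNReal.toReal_pos hκ0 (measure_ne_top _ _)).ne'
  have hprob : IsProbabilityMeasure ((ν univ)⁻¹ • ν) := inferInstance
  have hsub : ∀ d ∈ decisionRules Y, ∫ θ : Θ₀, (power μ f d θ - α) ∂ν
      = (ν univ).toNNReal * (∫ θ : Θ₀, power μ f d θ ∂((ν univ)⁻¹ • ν) - α) := by
    intro d hd
    rw [hscale, integral_sub (integrable_power hf hcont _ hd) (integrable_const _)]
    simp
  refine ⟨(ν univ).toNNReal, (ν univ)⁻¹ • ν, hprob, ?_, fun d hd => ?_⟩
  · rw [hsub δ hr, mul_eq_zero] at hslack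
    rcases hslack with h | h
    · exact absurd h (ENNReal.toReal_pos hκ0 (measure_ne_top _ _)).ne'
    · linarith
  · rw [← hsub d hd]
    exact hpen d hd

theorem exists_optimalRule_likelihoodRatio [SigmaFinite μ] (hf : IsDensityFamily μ f)
    (hcont : IsTVContinuousFamily μ f) {Θ₀ : Set Θ} (hΘ₀ : Θ₀.Nonempty) (hclosed : IsClosed Θ₀)
    (Λ₁ : Measure ↥Θ₀ᶜ) [IsProbabilityMeasure Λ₁] {α : ℝ} (hα : α ∈ Ioo (0 : ℝ) 1) {g : ℝ → ℝ}
    (hg_cont : ContinuousOn g (Icc 0 1)) (hg_diff : ContDiffOn ℝ 1 g (Ioo 0 1))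
    (hg_pos : ∀ t ∈ Ioo (0 : ℝ) 1, 0 < deriv g t) :
    ∃ δ : Y → ℝ, IsOptimalRule μ f g Λ₁ α δ ∧ (⨆ θ : Θ₀, power μ f δ θ) = α ∧
      (∀ θ : Θ, power μ f δ θ ∈ Ioo (0 : ℝ) 1) ∧
      ∃ (κ : ℝ≥0) (Λ₀ : Measure ↥Θ₀), IsProbabilityMeasure Λ₀ ∧
        IsLeastFavorable μ f α (weightedAlternative μ f g Λ₁ δ) Λ₀ ∧
        ∀ y : Y, (weightedAlternative μ f g Λ₁ δ y > κ * mixedNull f Λ₀ y → δ y = 1) ∧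
          (weightedAlternative μ f g Λ₁ δ y < κ * mixedNull f Λ₀ y → δ y = 0) := by
  have : Nonempty Θ := hΘ₀.to_type
  have hmono : MonotoneOn g (Icc 0 1) := (strictMonoOn_of_deriv_pos (convex_Icc 0 1) hg_cont
    (by rwa [interior_Icc])).monotoneOn
  obtain ⟨δ, hopt, hsup⟩ := exists_isOptimalRule_iSup_power_eq hf hcont hΘ₀ Λ₁ hα hg_cont hmono
  have hr : δ ∈ decisionRules Y := hopt.1.1
  have hrα := ((mem_feasibleRules_iff hf hΘ₀).1 hopt.1).2
  have hint : ∀ θ, power μ f δ θ ∈ Ioo (0 : ℝ) 1 :=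
    power_mem_Ioo hf hcont hr hΘ₀ (hsup ▸ hα)
  have hw : Continuous fun θ => deriv g (power μ f δ θ) :=
    (hg_diff.continuousOn_deriv_of_isOpen isOpen_Ioo le_rfl).comp_continuous
      (continuous_power hf hcont hr) hint
  have hw0 : ∀ θ, 0 < deriv g (power μ f δ θ) := fun θ => hg_pos _ (hint θ)
  obtain ⟨κ, Λ₀, hΛ₀, hslack, hpen⟩ := exists_null_multiplier hf hcont hΘ₀ hclosed Λ₁ hα.1 hw hw0
    hopt.1 (fun θ => (hint θ).2) (fun d hd => by
      have h := hopt.integral_deriv_mul_le hf hcont hΘ₀ hg_diff hint hd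
      simp only [mul_sub] at h
      rw [integral_sub (integrable_mul_power hf hcont Λ₁ hw hd.1)
        (integrable_mul_power hf hcont Λ₁ hw hr)] at h
      linarith)
  set H := weightedAlternative μ f g Λ₁ δ with hHdef
  have hHint : ∀ d ∈ decisionRules Y, ∫⁻ y, ENNReal.ofReal (d y) * H y ∂μ
      = ENNReal.ofReal (∫ θ : ↥Θ₀ᶜ, deriv g (power μ f δ θ) * power μ f d θ ∂Λ₁) := fun d hd =>
    lintegral_mul_weighted hf hcont Λ₁ hw (fun θ => (hw0 θ).le) hd
  have hnonneg : ∀ d ∈ decisionRules Y,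
      0 ≤ ∫ θ : ↥Θ₀ᶜ, deriv g (power μ f δ θ) * power μ f d θ ∂Λ₁ := fun d hd =>
    integral_nonneg fun θ => mul_nonneg (hw0 θ).le (power_nonneg hf hd θ)
  have hnonneg₀ : ∀ d ∈ decisionRules Y, 0 ≤ ∫ θ : Θ₀, power μ f d θ ∂Λ₀ := fun d hd =>
    integral_nonneg fun θ => power_nonneg hf hd θ
  have hKint : ∀ d ∈ decisionRules Y, ∫⁻ y, ENNReal.ofReal (d y) * (κ * mixedNull f Λ₀ y) ∂μ
      = ENNReal.ofReal (κ * ∫ θ : Θ₀, power μ f d θ ∂Λ₀) := fun d hd => by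
    rw [ENNReal.ofReal_mul κ.coe_nonneg, ← lintegral_mul_mixedNull hf hcont Λ₀ hd, ENNReal.ofReal_coe_nnreal,
      ← lintegral_const_mul' _ _ ENNReal.coe_ne_top]
    exact lintegral_congr fun y => by ring
  have h1 : (fun _ => (1 : ℝ)) ∈ decisionRules Y :=
    const_mem_decisionRules (right_mem_Icc.2 zero_le_one)
  have hHm : Measurable H := by
    have h := measurable_mixture hf Λ₁ measurable_subtype_coe
      (w := fun θ => ENNReal.ofReal (deriv g (power μ f δ θ)))
      (hw.measurable.comp measurable_subtype_coe).ennreal_ofReal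
    simp only [← ENNReal.ofReal_mul (hw0 _).le] at h
    exact h
  have hKm : Measurable fun y => κ * mixedNull f Λ₀ y := by
    have h := measurable_mixture hf Λ₀ measurable_subtype_coe (w := fun _ => 1) measurable_const
    simp only [one_mul] at h
    exact h.const_mul _
  obtain ⟨δ', hr', hae, hform⟩ := exists_ae_eq_likelihoodRatioRule (μ := μ) hHm hKm
    (by have h := hHint _ h1
        simp only [ENNReal.ofReal_one, one_mul] at h
        rw [h]; exact ENNReal.ofReal_ne_top)
    (by have h := hKint _ h1
        simp only [ENNReal.ofReal_one, one_mul] at h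
        rw [h]; exact ENNReal.ofReal_ne_top) hr (fun d hd => by
      rw [hHint d hd, hHint δ hr, hKint d hd, hKint δ hr,
        ← ENNReal.ofReal_add (hnonneg d hd) (mul_nonneg κ.coe_nonneg (hnonneg₀ δ hr)),
        ← ENNReal.ofReal_add (hnonneg δ hr) (mul_nonneg κ.coe_nonneg (hnonneg₀ d hd)), hslack]
      refine ENNReal.ofReal_le_ofReal ?_
      linarith [hpen d hd])
  -- A change on a μ-null set alters no power, hence neither optimality nor H; the same κ and Λ₀
  -- serve δ'.
  have hpow : ∀ θ, power μ f δ' θ = power μ f δ θ := power_congr_ae hae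
  have hobj : objective μ f g Λ₁ δ' = objective μ f g Λ₁ δ := by simp only [objective, hpow]
  have hsup' : (⨆ θ : Θ₀, power μ f δ' θ) = α := by simpa only [hpow] using hsup
  have hHeq : weightedAlternative μ f g Λ₁ δ' = H := by
    funext y
    simp only [hHdef, weightedAlternative, hpow]
  refine ⟨δ', ⟨⟨hr', hsup'.le⟩, fun d hd => (hopt.2 d hd).trans_eq hobj.symm⟩, hsup',
    fun θ => hpow θ ▸ hint θ, κ, Λ₀, hΛ₀, ?_, hHeq ▸ hform⟩
  rw [hHeq]
  -- δ is the competitor for Λ: its power is at most α throughout Θ₀, so also on Λ-average. Its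
  -- value bounds every `d` of level α for Λ₀, as the penalty of `d` is ≤ 0.
  refine ⟨hΛ₀, fun Λ hΛ => iSup₂_le fun d hd => ?_⟩
  obtain ⟨hd, hdα⟩ := hd
  rw [lintegral_mul_mixedNull hf hcont Λ₀ hd, ENNReal.ofReal_le_ofReal_iff hα.1.le] at hdα
  refine le_trans ?_ (le_iSup₂ (f := fun d (_ : d ∈ {d ∈ decisionRules Y |
    ∫⁻ y, ENNReal.ofReal (d y) * mixedNull f Λ y ∂μ ≤ ENNReal.ofReal α}) =>
      ∫⁻ y, ENNReal.ofReal (d y) * H y ∂μ) δ ⟨hr, ?_⟩)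
  · rw [hHint d hd, hHint δ hr]
    refine ENNReal.ofReal_le_ofReal ((hpen d hd).trans ?_)
    have := mul_nonneg κ.coe_nonneg (sub_nonneg.2 hdα)
    linarith
  · rw [lintegral_mul_mixedNull hf hcont Λ hr]
    refine ENNReal.ofReal_le_ofReal ?_
    refine (integral_mono (integrable_power hf hcont Λ hr) (integrable_const α)
      fun θ => hrα θ θ.2).trans_eq ?_
    simp

end Main

end CompositeNP

theorem theorem5 {d₁ d₂ : ℕ}
    (Θ : Set (EuclideanSpace ℝ (Fin d₁))) (hΘ : IsCompact Θ)
    (Y : Set (EuclideanSpace ℝ (Fin d₂))) (μ : Measure Y) [SigmaFinite μ]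
    (f : Θ → Y → ℝ) (hf : CompositeNP.IsDensityFamily μ f)
    (hcont : CompositeNP.IsTVContinuousFamily μ f)
    (Θ₀ : Set Θ) (hΘ₀ : Θ₀.Nonempty) (hΘ₁ : Θ₀ᶜ.Nonempty) (hΘ₀_closed : IsClosed Θ₀)
    (Λ₁ : Measure ↥Θ₀ᶜ) [IsProbabilityMeasure Λ₁]
    (α : ℝ) (hα : α ∈ Ioo (0 : ℝ) 1)
    (g : ℝ → ℝ) (hg_cont : ContinuousOn g (Icc 0 1)) (hg_diff : ContDiffOn ℝ 1 g (Ioo 0 1))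
    (hg_pos : ∀ t ∈ Ioo (0 : ℝ) 1, 0 < deriv g t) :
    ∃ δ : Y → ℝ,
      CompositeNP.IsOptimalRule μ f g Λ₁ α δ ∧
      (⨆ θ : Θ₀, CompositeNP.power μ f δ θ) = α ∧
      (∀ θ : Θ, CompositeNP.power μ f δ θ ∈ Ioo (0 : ℝ) 1) ∧
      ∃ (κ : ℝ≥0) (γ : Y → ℝ) (Λ₀ : Measure ↥Θ₀),
        γ ∈ CompositeNP.decisionRules Y ∧
        IsProbabilityMeasure Λ₀ ∧
        CompositeNP.IsLeastFavorable μ f α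
          (CompositeNP.weightedAlternative μ f g Λ₁ δ) Λ₀ ∧
        ∀ y : Y,
          (CompositeNP.weightedAlternative μ f g Λ₁ δ y > κ * CompositeNP.mixedNull f Λ₀ y →
            δ y = 1) ∧
          (CompositeNP.weightedAlternative μ f g Λ₁ δ y = κ * CompositeNP.mixedNull f Λ₀ y →
            δ y = γ y) ∧
          (CompositeNP.weightedAlternative μ f g Λ₁ δ y < κ * CompositeNP.mixedNull f Λ₀ y →
            δ y = 0) := by
  have : CompactSpace Θ := isCompact_iff_compactSpace.1 hΘ
  obtain ⟨δ, hopt, hsup, hint, κ, Λ₀, hΛ₀, hlf, hform⟩ :=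
    CompositeNP.exists_optimalRule_likelihoodRatio hf hcont hΘ₀ hΘ₀_closed Λ₁ hα hg_cont hg_diff
      hg_pos
  -- The rule itself serves as γ, which makes the tie clause trivial.
  exact ⟨δ, hopt, hsup, hint, κ, δ, Λ₀, hopt.1.1, hΛ₀, hlf,
    fun y => ⟨(hform y).1, fun _ => rfl, (hform y).2⟩⟩
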